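/- Let $\Gamma$ be an amenable discrete group, i.e. for every finite $K\subset\Gamma$ and every $\varepsilon>0$ there is a non-empty finite $\Omega\subset\Gamma$ with $|\gamma\Omega\,\triangle\,\Omega|\le\varepsilon|\Omega|$ for all $\gamma\in K$. Let $0<p\le\infty$. For a finite-dimensional real or complex normed vector space $V$ let $\ell^p(\Gamma;V)$ be the space of functions $x:\Gamma\to V$ with $\sum_{\gamma\in\Gamma}\|x(\gamma)\|^p<\infty$ (bounded functions if $p=\infty$), on which $\Gamma$ acts by $(\gamma x)(g)=x(\gamma^{-1}g)$. A map $f:\ell^p(\Gamma;V)\to\ell^p(\Gamma;V')$ is said to be of finite type if there are a finite set $D\subset\Gamma$ and a continuous map $\bar g:V^D\to V'$ such that $f(x)(\gamma)=\bar g\big((x(\gamma\delta))_{\delta\in D}\big)$ for all $x\in\ell^p(\Gamma;V)$ and $\gamma\in\Gamma$. (1) Let $V$ and $V'$ be finite-dimensional vector spaces over the same field ($\mathbb{R}$ or $\mathbb{C}$). If $f:\ell^p(\Gamma;V)\to\ell^p(\Gamma;V')$ is an injective $\Gamma$-equivariant linear map of finite type, then $\dim V\le\dim V'$. (2) For all integers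 $n,m\ge 0$, there is a $\Gamma$-equivariant linear bijection of finite type from $\ell^p(\Gamma;\mathbb{R}^n)$ to $\ell^p(\Gamma;\mathbb{R}^m)$ if and only if $n=m$. -/

import Mathlib

open scoped ENNReal Pointwise symmDiff

noncomputable section

/-- A discrete group is amenable if it satisfies the Følner condition: for every finite set `K` of
group elements and every `ε > 0` there is a nonempty finite set `Ω` with
`|γ Ω ∆ Ω| ≤ ε |Ω|` for all `γ ∈ K`. -/
def IsAmenableGroup (Γ : Type*) [Group Γ] : Prop :=
  ∀ (K : Finset Γ) (ε : ℝ), 0 < ε → ∃ Ω : Finset Γ, Ω.Nonempty ∧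
    ∀ γ ∈ K, (((γ • (Ω : Set Γ)) ∆ (Ω : Set Γ)).ncard : ℝ) ≤ ε * (Ω.card : ℝ)

/-- The space `ℓ^p(Γ; V)` of `p`-summable functions `Γ → V`
(bounded functions for `p = ∞`). -/
abbrev EllP (Γ V : Type*) [NormedAddCommGroup V] (p : ℝ≥0∞) : Type _ :=
  lp (fun _ : Γ => V) p

section

variable {Γ V V' : Type*} [Group Γ] [NormedAddCommGroup V] [NormedAddCommGroup V'] {p : ℝ≥0∞}

/-- Precomposition with a left translation preserves `p`-summability. -/
theorem memℓp_comp_mul_left (γ : Γ) {x : Γ → V} (hx : Memℓp x p) :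
    Memℓp (fun g => x (γ * g)) p := by
  rcases p.trichotomy with (rfl | rfl | hp)
  · exact memℓp_zero ((memℓp_zero_iff.1 hx).preimage (mul_right_injective γ).injOn)
  · refine memℓp_infty ((memℓp_infty_iff.1 hx).mono ?_)
    rintro _ ⟨g, rfl⟩
    exact ⟨γ * g, rfl⟩
  · exact memℓp_gen (((memℓp_gen_iff hp).1 hx).comp_injective (mul_right_injective γ))

/-- The natural action of `Γ` on `ℓ^p(Γ; V)`: `(γ x)(g) = x(γ⁻¹ g)`. -/
def EllP.translate (γ : Γ) (x : EllP Γ V p) : EllP Γ V p :=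
  ⟨fun g => x (γ⁻¹ * g), memℓp_comp_mul_left γ⁻¹ x.2⟩

/-- `f` commutes with the natural actions of `Γ`. -/
def EllP.IsEquivariant (f : EllP Γ V p → EllP Γ V' p) : Prop :=
  ∀ (γ : Γ) (x : EllP Γ V p), f (EllP.translate γ x) = EllP.translate γ (f x)

/-- `f` is of finite type: there are a finite set `D ⊆ Γ` and a continuous map `g : V^D → V'` with
`f(x)(γ) = g((x(γ δ))_{δ ∈ D})` for all `x` and `γ`. -/
def EllP.IsFiniteType (f : EllP Γ V p → EllP Γ V' p) : Prop :=
  ∃ (D : Finset Γ) (g : (D → V) → V'), Continuous g ∧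
    ∀ (x : EllP Γ V p) (γ : Γ), f x γ = g (fun δ => x (γ * δ))

end

end

section

variable {Γ : Type*} [Group Γ]

/-! With memory set `D`, the values of `f x` on `Ω` depend only on `x` on `Ω * D`, and `x` supported
in `Ω` gives `f x` supported in `Ω * D⁻¹`. So an injective `f` embeds `V^Ω` into `V'^(Ω * D⁻¹)`, and
a surjective one maps `V^(Ω * D)` onto `V'^Ω`. Comparing dimensions over Følner sets, whose
thickenings have relative size close to 1, leaves an inequality of integers. -/

open scoped Classical in
theorem IsAmenableGroup.exists_card_mul_lt (hΓ : IsAmenableGroup Γ) (D : Finset Γ) (k : ℕ) :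
    ∃ Ω : Finset Γ, Ω.Nonempty ∧ (D * Ω).card * k < Ω.card * (k + 1) := by
  -- The excess of `D * Ω` over `Ω` is at most `D.card * ε * Ω.card`; this `ε` makes `D.card * k * ε
  -- < 1`, even when `D.card * k = 0`.
  have hε : (0 : ℝ) < 1 / (D.card * k + 1) := by positivity
  obtain ⟨Ω, hne, hΩ⟩ := hΓ D _ hε
  refine ⟨Ω, hne, ?_⟩
  have hpos : (0 : ℝ) < Ω.card := by exact_mod_cast hne.card_pos
  have hsub : D * Ω ⊆ Ω ∪ D.biUnion fun δ => (δ • Ω) \ Ω := by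
    intro x hx
    obtain ⟨δ, hδ, ω, hω, rfl⟩ := Finset.mem_mul.1 hx
    by_cases h : δ * ω ∈ Ω
    · exact Finset.mem_union_left _ h
    · exact Finset.mem_union_right _ <| Finset.mem_biUnion.2
        ⟨δ, hδ, Finset.mem_sdiff.2 ⟨Finset.smul_mem_smul_finset hω, h⟩⟩
  have hbound : ∀ δ ∈ D, (((δ • Ω) \ Ω).card : ℝ) ≤ 1 / (D.card * k + 1) * Ω.card := by
    intro δ hδ
    refine le_trans ?_ (hΩ δ hδ)
    rw [← Finset.coe_smul_finset, ← Finset.coe_symmDiff, Set.ncard_coe_finset]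
    exact_mod_cast Finset.card_le_card fun x hx =>
      Finset.mem_symmDiff.2 (Or.inl (Finset.mem_sdiff.1 hx))
  have hcard : ((D * Ω).card : ℝ) ≤ Ω.card + D.card * (1 / (D.card * k + 1) * Ω.card) := by
    calc ((D * Ω).card : ℝ)
        ≤ Ω.card + ∑ δ ∈ D, (((δ • Ω) \ Ω).card : ℝ) := by
          exact_mod_cast (Finset.card_le_card hsub).trans
            ((Finset.card_union_le _ _).trans (Nat.add_le_add_left Finset.card_biUnion_le _))
      _ ≤ _ := by
          gcongr
          simpa using Finset.sum_le_sum hbound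
  have hlt : (D.card * k : ℝ) * (1 / (D.card * k + 1)) < 1 := by
    rw [mul_one_div, div_lt_one (by positivity)]
    linarith
  have hfin : ((D * Ω).card : ℝ) * k < Ω.card * (k + 1) :=
    calc ((D * Ω).card : ℝ) * k
        ≤ (Ω.card + D.card * (1 / (D.card * k + 1) * Ω.card)) * k := by gcongr
      _ = Ω.card * k + (D.card * k : ℝ) * (1 / (D.card * k + 1)) * Ω.card := by ring
      _ < Ω.card * k + 1 * Ω.card := by gcongr
      _ = Ω.card * (k + 1) := by ring
  exact_mod_cast hfin

open scoped Classical in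
theorem IsAmenableGroup.le_of_card_mul_le (hΓ : IsAmenableGroup Γ) (D : Finset Γ) {a b : ℕ}
    (h : ∀ Ω : Finset Γ, Ω.card * a ≤ (Ω * D).card * b) : a ≤ b := by
  -- Følner sets control left translates, but `D` multiplies on the right; inversion swaps the
  -- sides.
  obtain ⟨Ω, -, hΩ⟩ := hΓ.exists_card_mul_lt D⁻¹ b
  have h' := h Ω⁻¹
  rw [← inv_inv (Ω⁻¹ * D), mul_inv_rev, inv_inv, Finset.card_inv, Finset.card_inv] at h'
  exact Nat.lt_succ_iff.1 (lt_of_mul_lt_mul_left (h'.trans_lt hΩ) (Nat.zero_le _))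

end

namespace EllP

section

variable {Γ V : Type*} [NormedAddCommGroup V] {p : ℝ≥0∞} {𝕜 : Type*} [RCLike 𝕜] [NormedSpace 𝕜 V]

open scoped Classical in
/-- Extension by zero of functions on a finite set. -/
noncomputable def extend (𝕜 : Type*) [RCLike 𝕜] [NormedSpace 𝕜 V] (p : ℝ≥0∞) (S : Finset Γ) :
    (S → V) →ₗ[𝕜] EllP Γ V p where
  toFun y := ⟨fun γ => if h : γ ∈ S then y ⟨γ, h⟩ else 0, by
    -- Finite support means membership in `ℓ^0`, which lies in every `ℓ^p`.
    refine Memℓp.of_exponent_ge (memℓp_zero ?_) (zero_le (a := p))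
    refine S.finite_toSet.subset fun γ hγ => ?_
    by_contra h
    exact hγ (dif_neg h)⟩
  map_add' y z := by
    ext γ
    change (if h : γ ∈ S then (y + z) ⟨γ, h⟩ else 0) =
      (if h : γ ∈ S then y ⟨γ, h⟩ else 0) + if h : γ ∈ S then z ⟨γ, h⟩ else 0
    by_cases h : γ ∈ S <;> simp [h]
  map_smul' c y := by
    ext γ
    by_cases h : γ ∈ S <;> simp [h]

/-- Restriction to a finite set. -/
def restrict (𝕜 : Type*) [RCLike 𝕜] [NormedSpace 𝕜 V] (p : ℝ≥0∞) (S : Finset Γ) :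
    EllP Γ V p →ₗ[𝕜] (S → V) where
  toFun x γ := x γ
  map_add' _ _ := rfl
  map_smul' _ _ := rfl

@[simp]
theorem restrict_apply (S : Finset Γ) (x : EllP Γ V p) (γ : S) :
    restrict 𝕜 p S x γ = x γ := rfl

theorem extend_apply_of_mem {S : Finset Γ} (y : S → V) {γ : Γ} (h : γ ∈ S) :
    extend 𝕜 p S y γ = y ⟨γ, h⟩ := dif_pos h

theorem extend_apply_of_notMem {S : Finset Γ} (y : S → V) {γ : Γ} (h : γ ∉ S) :
    extend 𝕜 p S y γ = 0 := dif_neg h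

theorem restrict_extend (S : Finset Γ) (y : S → V) :
    restrict 𝕜 p S (extend 𝕜 p S y) = y :=
  funext fun γ => extend_apply_of_mem (𝕜 := 𝕜) (p := p) y γ.2

theorem extend_injective (S : Finset Γ) :
    Function.Injective (extend 𝕜 p S : (S → V) →ₗ[𝕜] EllP Γ V p) :=
  Function.LeftInverse.injective (g := restrict 𝕜 p S) (restrict_extend S)

end

section

variable {Γ V V' : Type*} [Group Γ] [NormedAddCommGroup V] [NormedAddCommGroup V'] {p : ℝ≥0∞}
variable {𝕜 : Type*} [RCLike 𝕜] [NormedSpace 𝕜 V] [NormedSpace 𝕜 V']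
variable [FiniteDimensional 𝕜 V] [FiniteDimensional 𝕜 V']

/-- An injective linear map of finite type over an amenable group does not lower the dimension. -/
theorem finrank_le_of_injective (hΓ : IsAmenableGroup Γ) (f : EllP Γ V p →ₗ[𝕜] EllP Γ V' p)
    (hinj : Function.Injective f) (hf : IsFiniteType f) :
    Module.finrank 𝕜 V ≤ Module.finrank 𝕜 V' := by
  classical
  obtain ⟨D, g, -, hg⟩ := hf
  have hg0 : g 0 = 0 := by
    have h := hg 0 1
    rw [map_zero] at h
    exact h.symm
  refine hΓ.le_of_card_mul_le D⁻¹ fun Ω => ?_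
  have hL : Function.Injective (restrict 𝕜 p (Ω * D⁻¹) ∘ₗ f ∘ₗ extend 𝕜 p Ω) := by
    refine (injective_iff_map_eq_zero _).2 fun y hy => ?_
    refine extend_injective (𝕜 := 𝕜) (p := p) Ω (hinj ?_)
    rw [map_zero, map_zero]
    ext γ
    -- Off `Ω * D⁻¹` every `γ * δ` misses `Ω`, so `f` takes the value `g 0 = 0` there.
    by_cases h : γ ∈ Ω * D⁻¹
    · exact congrFun hy ⟨γ, h⟩
    · rw [hg]
      refine (congrArg g (funext fun δ => extend_apply_of_notMem (𝕜 := 𝕜) (p := p) y fun hδ => h ?_)).trans hg0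
      exact Finset.mem_mul.2 ⟨γ * δ, hδ, (δ : Γ)⁻¹, Finset.inv_mem_inv δ.2, by group⟩
  simpa [Module.finrank_pi_fintype] using LinearMap.finrank_le_finrank_of_injective hL

/-- A surjective linear map of finite type over an amenable group does not raise the dimension. -/
theorem finrank_le_of_surjective (hΓ : IsAmenableGroup Γ) (f : EllP Γ V p →ₗ[𝕜] EllP Γ V' p)
    (hsurj : Function.Surjective f) (hf : IsFiniteType f) :
    Module.finrank 𝕜 V' ≤ Module.finrank 𝕜 V := by
  classical
  obtain ⟨D, g, -, hg⟩ := hf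
  refine hΓ.le_of_card_mul_le D fun Ω => ?_
  have hL : Function.Surjective (restrict 𝕜 p Ω ∘ₗ f ∘ₗ extend 𝕜 p (Ω * D)) := by
    intro z
    obtain ⟨x, hx⟩ := hsurj (extend 𝕜 p Ω z)
    -- Truncating `x` to `Ω * D` does not change `f x` on `Ω`.
    refine ⟨restrict 𝕜 p (Ω * D) x, funext fun γ => ?_⟩
    rw [← restrict_extend (𝕜 := 𝕜) (p := p) Ω z, ← hx]
    simp only [LinearMap.comp_apply, restrict_apply, hg]
    exact congrArg g (funext fun δ => extend_apply_of_mem (𝕜 := 𝕜) (p := p) _ (Finset.mul_mem_mul γ.2 δ.2))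
  simpa [Module.finrank_pi_fintype] using LinearMap.finrank_le_finrank_of_surjective hL

end

theorem isFiniteType_id {Γ V : Type*} [Group Γ] [NormedAddCommGroup V] {p : ℝ≥0∞} :
    IsFiniteType (id : EllP Γ V p → EllP Γ V p) :=
  ⟨{1}, fun v => v ⟨1, Finset.mem_singleton_self 1⟩, continuous_apply _, fun x γ => by simp⟩

end EllP

theorem theorem1 {Γ : Type*} [Group Γ] (hΓ : IsAmenableGroup Γ) (p : ℝ≥0∞) (hp : 0 < p) :
    (∀ (𝕜 : Type*) [RCLike 𝕜] (V V' : Type*)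
        [NormedAddCommGroup V] [NormedSpace 𝕜 V] [FiniteDimensional 𝕜 V]
        [NormedAddCommGroup V'] [NormedSpace 𝕜 V'] [FiniteDimensional 𝕜 V']
        (f : EllP Γ V p →ₗ[𝕜] EllP Γ V' p),
        Function.Injective f → EllP.IsEquivariant f → EllP.IsFiniteType f →
        Module.finrank 𝕜 V ≤ Module.finrank 𝕜 V') ∧
    (∀ n m : ℕ,
        (∃ e : EllP Γ (EuclideanSpace ℝ (Fin n)) p ≃ₗ[ℝ] EllP Γ (EuclideanSpace ℝ (Fin m)) p,
          EllP.IsEquivariant e ∧ EllP.IsFiniteType e) ↔ n = m) := by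
  refine ⟨fun 𝕜 _ V V' _ _ _ _ _ _ f hinj _ hf => EllP.finrank_le_of_injective hΓ f hinj hf,
    fun n m => ⟨?_, ?_⟩⟩
  · rintro ⟨e, -, he⟩
    simpa using le_antisymm (EllP.finrank_le_of_injective hΓ e.toLinearMap e.injective he)
      (EllP.finrank_le_of_surjective hΓ e.toLinearMap e.surjective he)
  · rintro rfl
    exact ⟨LinearEquiv.refl ℝ _, fun _ _ => rfl, EllP.isFiniteType_id⟩
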